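/- Let $n\ge 3$, $m=\frac{n-2}{n+2}$, $\beta>\frac{\rho}{2}>0$ and $\alpha=\frac{2\beta+\rho}{1-m}$. Let $v$ be a radially symmetric classical ($C^2$) solution of $$\frac{n-1}{m}\Delta v^m+\alpha v+\beta\, x\cdot\nabla v=0,\quad v>0,\quad\text{in }\mathbb{R}^n,$$ and write $v(x)=v(r)$ with $r=|x|$. Then $$\lim_{r\to\infty}\frac{rv'(r)}{v(r)}=-\frac{2}{1-m}.$$ The scalar curvature of the Riemannian metric $g=v^{\frac{4}{n+2}}dx^2$ on $\mathbb{R}^n$ is a function $R(r)$ of $r=|x|$ only, and $$\lim_{r\to\infty}R(r)=\rho.$$ For $x\neq 0$, the sectional curvature of $g$ at $x$ is the same number $K_0(r)$, $r=|x|$, for all $2$-planes that are perpendicular to the sphere of radius $r$ centred at the origin (that is, that contain the radial direction $x$), and the same number $K_1(r)$ for all $2$-planes that are tangent to this sphere, and $$\lim_{r\to\infty}K_0(r)=0,\qquad \lim_{r\to\infty}K_1(r)=\frac{\rho}{(n-1)(n-2)}.$$ -/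

import Mathlib

open Filter Topology
open scoped InnerProductSpace Gradient Laplacian

noncomputable section

/-- `v` is a (positive, classical) solution on `ℝⁿ` of
`((n - 1) / m) Δ(v ^ m) + α v + β x · ∇v = 0`. -/
structure IsEllipticSolution (n : ℕ) (m α β : ℝ) (v : EuclideanSpace ℝ (Fin n) → ℝ) : Prop where
  contDiff : ContDiff ℝ 2 v
  pos : ∀ x, 0 < v x
  eqn : ∀ x, ((n : ℝ) - 1) / m * (Δ (fun y => v y ^ m)) x + α * v x + β * ⟪x, ∇ v x⟫_ℝ = 0

namespace CoordMetric

/-- A (`0`,`2`)-tensor field on `ℝⁿ`, given by its matrix `g_{ij}(x)` in the standard coordinates. -/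
abbrev Field (n : ℕ) : Type := EuclideanSpace ℝ (Fin n) → Matrix (Fin n) (Fin n) ℝ

/-- The coordinate derivative `∂_i f (x)`. -/
def pd {n : ℕ} (i : Fin n) (f : EuclideanSpace ℝ (Fin n) → ℝ) (x : EuclideanSpace ℝ (Fin n)) : ℝ :=
  fderiv ℝ f x (EuclideanSpace.single i 1)

/-- Christoffel symbol of the Levi-Civita connection:
`Γ^k_{ij} = (1/2) ∑ₗ g^{kl} (∂_i g_{jl} + ∂_j g_{il} - ∂_l g_{ij})`. -/
def christoffel {n : ℕ} (g : Field n) (k i j : Fin n) (x : EuclideanSpace ℝ (Fin n)) : ℝ :=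
  (1 / 2) * ∑ l, (g x)⁻¹ k l *
    (pd i (fun y => g y j l) x + pd j (fun y => g y i l) x - pd l (fun y => g y i j) x)

/-- The component `R^l_{kij}` of the curvature tensor
`R(X,Y)Z = ∇_X ∇_Y Z - ∇_Y ∇_X Z - ∇_{[X,Y]} Z`, i.e. `R(∂_i, ∂_j) ∂_k = ∑ₗ R^l_{kij} ∂_l`. -/
def riemann {n : ℕ} (g : Field n) (l k i j : Fin n) (x : EuclideanSpace ℝ (Fin n)) : ℝ :=
  pd i (christoffel g l j k) x - pd j (christoffel g l i k) x
    + ∑ a, (christoffel g l i a x * christoffel g a j k x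
      - christoffel g l j a x * christoffel g a i k x)

/-- Ricci tensor: `Ric_{jk} = ∑ᵢ R^i_{kij}`. -/
def ricci {n : ℕ} (g : Field n) (j k : Fin n) (x : EuclideanSpace ℝ (Fin n)) : ℝ :=
  ∑ i, riemann g i k i j x

/-- Scalar curvature: `∑ g^{jk} Ric_{jk}`. -/
def scalarCurvature {n : ℕ} (g : Field n) (x : EuclideanSpace ℝ (Fin n)) : ℝ :=
  ∑ j, ∑ k, (g x)⁻¹ j k * ricci g j k x

/-- `g_x(u, w)`. -/
def pair {n : ℕ} (g : Field n) (x u w : EuclideanSpace ℝ (Fin n)) : ℝ :=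
  ∑ i, ∑ j, g x i j * u i * w j

/-- The vector `R(u, w) z` at the point `x`. -/
def curv {n : ℕ} (g : Field n) (x u w z : EuclideanSpace ℝ (Fin n)) : EuclideanSpace ℝ (Fin n) :=
  WithLp.toLp 2 fun l => ∑ k, ∑ i, ∑ j, riemann g l k i j x * u i * w j * z k

/-- Sectional curvature at `x` of the `2`-plane spanned by the (linearly independent) tangent vectors
`u`, `w`: `g(R(u,w)w, u) / (g(u,u) g(w,w) - g(u,w)²)`. -/
def sectionalCurvature {n : ℕ} (g : Field n) (x u w : EuclideanSpace ℝ (Fin n)) : ℝ :=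
  pair g x (curv g x u w w) u / (pair g x u u * pair g x w w - pair g x u w ^ 2)

/-- The metric `v ^ (4 / (n + 2)) dx²` on `ℝⁿ`. -/
def yamabe {n : ℕ} (v : EuclideanSpace ℝ (Fin n) → ℝ) : Field n :=
  fun x => (v x ^ (4 / ((n : ℝ) + 2))) • (1 : Matrix (Fin n) (Fin n) ℝ)

end CoordMetric

end

/-! Put `ψ = 2 / (n + 2) * log v`, so that the metric is `exp (2ψ) dx²`, and use the logarithmic
radius `s = log r`. With `η(s) = ψ` at radius `exp s` and `y = s + η`, the metric off the origin is
the warped cylinder `exp (2y) (ds² + dω²)`. Its curvatures are `K₀ = -y'' / exp (2y)`, `K₁ = (1 -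
y'²) / exp (2y)` and `R = 2(n-1)K₀ + (n-1)(n-2)K₁`, while `r v' / v = (n+2)/2 * (y' - 1)`. All four
limits thus follow from `y' → 0`, `y'' → 0` and `exp (2y) → (n-1)(n-2)/ρ`.

The elliptic equation becomes an autonomous ODE for `y` (`radial_ode`), that of a damped particle in
a potential well. Smoothness of `v` at the origin says that `y → -∞` and `y' → 1` as `s → -∞`. An
energy that starts from zero there and is dissipated at rate `β exp (n y) y'²` traps the orbit in a
bounded region, and Barbalat's lemma forces it to come to rest at the equilibrium
(`cylinder_ode_tendsto`). -/

namespace CoordMetric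

/-! ### Curvature of conformally flat metrics in coordinates. -/

variable {n : ℕ}

theorem pd_eq_of_hasFDerivAt {f : EuclideanSpace ℝ (Fin n) → ℝ} {f' : EuclideanSpace ℝ (Fin n) →L[ℝ] ℝ}
    {x : EuclideanSpace ℝ (Fin n)} (h : HasFDerivAt f f' x) (i : Fin n) :
    pd i f x = f' (EuclideanSpace.single i 1) := by rw [pd, h.fderiv]

theorem pd_congr {f g : EuclideanSpace ℝ (Fin n) → ℝ} {x : EuclideanSpace ℝ (Fin n)}
    (h : f =ᶠ[𝓝 x] g) (i : Fin n) : pd i f x = pd i g x := by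
  rw [pd, pd, h.fderiv_eq]

theorem pd_pd_eq {f : EuclideanSpace ℝ (Fin n) → ℝ} {x : EuclideanSpace ℝ (Fin n)}
    (hf : ContDiffAt ℝ 2 f x) (i j : Fin n) :
    pd i (pd j f) x = fderiv ℝ (fderiv ℝ f) x (EuclideanSpace.single i 1)
      (EuclideanSpace.single j 1) := by
  have h : DifferentiableAt ℝ (fderiv ℝ f) x :=
    (hf.fderiv_right (m := 1) (by norm_num)).differentiableAt (by norm_num)
  exact pd_eq_of_hasFDerivAt (h.hasFDerivAt.clm_apply (hasFDerivAt_const _ x)) i |>.trans (by simp)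

theorem pd_comm {f : EuclideanSpace ℝ (Fin n) → ℝ} {x : EuclideanSpace ℝ (Fin n)}
    (hf : ContDiffAt ℝ 2 f x) (i j : Fin n) : pd i (pd j f) x = pd j (pd i f) x := by
  rw [pd_pd_eq hf, pd_pd_eq hf]
  exact hf.isSymmSndFDerivAt (by simp) _ _

theorem laplacian_eq_sum_pd {f : EuclideanSpace ℝ (Fin n) → ℝ} {x : EuclideanSpace ℝ (Fin n)}
    (hf : ContDiffAt ℝ 2 f x) : (Δ f) x = ∑ i, pd i (pd i f) x := by
  rw [InnerProductSpace.laplacian_eq_iteratedFDeriv_orthonormalBasis f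
    (EuclideanSpace.basisFun (Fin n) ℝ)]
  refine Finset.sum_congr rfl fun i _ => ?_
  rw [pd_pd_eq hf, iteratedFDeriv_two_apply]
  simp

/-- The Kronecker delta. -/
local notation "δ" => (1 : Matrix (Fin n) (Fin n) ℝ)

/-- The conformally flat metric `exp (2 ψ) dx²`. -/
noncomputable def conformal (ψ : EuclideanSpace ℝ (Fin n) → ℝ) : Field n :=
  fun x => Real.exp (2 * ψ x) • (1 : Matrix (Fin n) (Fin n) ℝ)

/-- The tensor `∇²ψ - dψ ⊗ dψ + |dψ|² / 2` governing the curvature of `exp (2 ψ) dx²`. -/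
noncomputable def schouten (ψ : EuclideanSpace ℝ (Fin n) → ℝ) (x : EuclideanSpace ℝ (Fin n)) (i j : Fin n) : ℝ :=
  pd i (pd j ψ) x - pd i ψ x * pd j ψ x + (∑ a, pd a ψ x ^ 2) / 2 * (1 : Matrix (Fin n) (Fin n) ℝ) i j

theorem conformal_inv (ψ : EuclideanSpace ℝ (Fin n) → ℝ) (x : EuclideanSpace ℝ (Fin n)) :
    (conformal ψ x)⁻¹ = (Real.exp (2 * ψ x))⁻¹ • (1 : Matrix (Fin n) (Fin n) ℝ) := by
  apply Matrix.inv_eq_right_inv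
  rw [conformal, smul_mul_smul_comm, mul_inv_cancel₀ (Real.exp_pos _).ne', one_mul, one_smul]

theorem christoffel_conformal {ψ : EuclideanSpace ℝ (Fin n) → ℝ} (hψ : ContDiff ℝ 2 ψ) (k i j : Fin n)
    (x : EuclideanSpace ℝ (Fin n)) :
    christoffel (conformal ψ) k i j x = pd i ψ x * δ j k + pd j ψ x * δ i k - pd k ψ x * δ i j := by
  have hd : ∀ a b c : Fin n, pd a (fun y => conformal ψ y b c) x =
      2 * Real.exp (2 * ψ x) * pd a ψ x * δ b c := by
    intro a b c
    have h := (hψ.differentiable (by norm_num) x).hasFDerivAt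
    have := pd_eq_of_hasFDerivAt (((h.const_mul 2).exp).mul_const (δ b c)) a
    simp only [conformal, Matrix.smul_apply, smul_eq_mul]
    rw [this]
    simp [pd]; ring
  have he := (Real.exp_pos (2 * ψ x)).ne'
  simp only [christoffel, hd, conformal_inv, Matrix.smul_apply, smul_eq_mul]
  rw [Finset.sum_eq_single k]
  · simp only [Matrix.one_apply_eq]
    field_simp
  · intro l _ hl
    simp [Matrix.one_apply_ne hl.symm]
  · simp

theorem differentiable_pd {ψ : EuclideanSpace ℝ (Fin n) → ℝ} (hψ : ContDiff ℝ 2 ψ) (i : Fin n) :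
    Differentiable ℝ (pd i ψ) := fun x =>
  (((hψ.fderiv_right (m := 1) (by norm_num)).differentiable (by norm_num) x).clm_apply
    (differentiableAt_const _))

/-- A conformally flat metric has no Weyl part. The Christoffel symbols are linear in `dψ`: their
derivatives give the Hessian terms, their products the quadratic ones, and symmetry of the Hessian
cancels the `δ k l` terms. -/
theorem riemann_conformal {ψ : EuclideanSpace ℝ (Fin n) → ℝ} (hψ : ContDiff ℝ 2 ψ) (l k i j : Fin n)
    (x : EuclideanSpace ℝ (Fin n)) :
    riemann (conformal ψ) l k i j x = schouten ψ x i k * δ j l - schouten ψ x i l * δ j k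
      - schouten ψ x j k * δ i l + schouten ψ x j l * δ i k := by
  have hd : ∀ i j l k, pd i (christoffel (conformal ψ) l j k) x = pd i (pd j ψ) x * δ k l +
      pd i (pd k ψ) x * δ j l - pd i (pd l ψ) x * δ j k := by
    intro i j l k
    rw [show christoffel (conformal ψ) l j k = _ from funext (christoffel_conformal hψ l j k)]
    have h := fun a => (differentiable_pd hψ a x).hasFDerivAt
    have := pd_eq_of_hasFDerivAt ((((h j).mul_const (δ k l)).add ((h k).mul_const (δ j l))).sub
      ((h l).mul_const (δ j k))) i
    refine Eq.trans this ?_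
    simp [pd]; ring
  have hs : ∀ i j l k, ∑ a, christoffel (conformal ψ) l i a x * christoffel (conformal ψ) a j k x =
      pd i ψ x * (pd j ψ x * δ k l + pd k ψ x * δ j l - pd l ψ x * δ j k) +
      δ i l * (2 * (pd j ψ x * pd k ψ x) - (∑ a, pd a ψ x ^ 2) * δ j k) -
      pd l ψ x * (pd j ψ x * δ i k + pd k ψ x * δ i j - pd i ψ x * δ j k) := by
    intro i j l k
    simp only [christoffel_conformal hψ, Matrix.one_apply, add_mul, mul_add, sub_mul, mul_sub,
      Finset.sum_add_distrib, Finset.sum_sub_distrib, mul_ite, ite_mul, mul_one, mul_zero, zero_mul,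
      Finset.sum_ite_eq, Finset.mem_univ, if_true, one_mul]
    by_cases h1 : j = k <;> by_cases h2 : i = l <;>
      simp [h1, h2, Finset.sum_add_distrib, Finset.sum_sub_distrib, sq] <;> ring
  rw [riemann, hd, hd, Finset.sum_sub_distrib, hs, hs, pd_comm hψ.contDiffAt j i]
  simp only [schouten]
  have h1 : δ j i = δ i j := congrFun (congrFun (Matrix.transpose_one (n := Fin n) (α := ℝ)) i) j
  rw [h1]
  ring

theorem scalarCurvature_conformal {ψ : EuclideanSpace ℝ (Fin n) → ℝ} (hψ : ContDiff ℝ 2 ψ)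
    (x : EuclideanSpace ℝ (Fin n)) :
    scalarCurvature (conformal ψ) x =
      -2 * ((n : ℝ) - 1) * (∑ i, schouten ψ x i i) / Real.exp (2 * ψ x) := by
  have hr : ∀ j k, ricci (conformal ψ) j k x =
      -((n : ℝ) - 2) * schouten ψ x j k - (∑ i, schouten ψ x i i) * δ j k := by
    intro j k
    simp only [ricci, riemann_conformal hψ, Finset.sum_add_distrib, Finset.sum_sub_distrib,
      Matrix.one_apply, if_true, mul_one, mul_ite, mul_zero, Finset.sum_ite_eq, Finset.sum_ite_eq',
      Finset.mem_univ, Finset.sum_const, Finset.card_univ, Fintype.card_fin, nsmul_eq_mul]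
    split_ifs <;> simp <;> ring
  simp only [scalarCurvature, hr, conformal_inv, Matrix.smul_apply, Matrix.one_apply, smul_eq_mul,
    mul_ite, ite_mul, mul_one, mul_zero, zero_mul, Finset.sum_ite_eq, Finset.mem_univ, if_true]
  rw [← Finset.mul_sum, Finset.sum_sub_distrib, ← Finset.mul_sum]
  simp
  field_simp
  ring

theorem pair_conformal (ψ : EuclideanSpace ℝ (Fin n) → ℝ) (x u w : EuclideanSpace ℝ (Fin n)) :
    pair (conformal ψ) x u w = Real.exp (2 * ψ x) * ⟪u, w⟫_ℝ := by
  simp [pair, conformal, Matrix.one_apply, PiLp.inner_apply, Finset.mul_sum]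
  refine Finset.sum_congr rfl fun i _ => by ring

/-- The form `P δ + Q x ⊗ x` of the Schouten-type tensor is the one that a radial `ψ` produces. -/
theorem curv_conformal {ψ : EuclideanSpace ℝ (Fin n) → ℝ} (hψ : ContDiff ℝ 2 ψ)
    {P Q : ℝ} {x : EuclideanSpace ℝ (Fin n)}
    (hA : ∀ i j, schouten ψ x i j = P * δ i j + Q * (x i * x j))
    (u w z : EuclideanSpace ℝ (Fin n)) :
    curv (conformal ψ) x u w z =
      (2 * P * ⟪u, z⟫_ℝ + Q * ⟪x, u⟫_ℝ * ⟪x, z⟫_ℝ) • w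
      - (2 * P * ⟪w, z⟫_ℝ + Q * ⟪x, w⟫_ℝ * ⟪x, z⟫_ℝ) • u
      + (Q * (⟪x, w⟫_ℝ * ⟪u, z⟫_ℝ - ⟪x, u⟫_ℝ * ⟪w, z⟫_ℝ)) • x := by
  ext l
  have h : ∀ k i j, riemann (conformal ψ) l k i j x * u i * w j * z k =
      2 * P * (δ i k * u i * z k * (δ j l * w j)) - 2 * P * (δ j k * w j * z k * (δ i l * u i))
      + Q * ((x i * u i) * (x k * z k) * (δ j l * w j)) - Q * ((x j * w j) * (x k * z k) * (δ i l * u i))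
      + Q * ((x j * w j) * (δ i k * u i * z k) * x l) - Q * ((x i * u i) * (δ j k * w j * z k) * x l) := by
    intro k i j
    rw [riemann_conformal hψ]
    simp only [hA]
    ring
  simp only [curv, h]
  simp only [Finset.sum_add_distrib, Finset.sum_sub_distrib, ← Finset.mul_sum, ← Finset.sum_mul]
  have hin : ∀ a b : EuclideanSpace ℝ (Fin n), ⟪a, b⟫_ℝ = ∑ i, a i * b i := fun a b => by
    simp [PiLp.inner_apply, mul_comm]
  simp only [Matrix.one_apply, ite_mul, one_mul, zero_mul, Finset.sum_ite_eq', Finset.mem_univ,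
    if_true, ← hin, PiLp.add_apply, PiLp.sub_apply, PiLp.smul_apply, smul_eq_mul]
  ring

/-- This is the determinant of a positive definite Gram matrix. -/
theorem inner_mul_inner_sub_sq_pos {u w : EuclideanSpace ℝ (Fin n)}
    (h : LinearIndependent ℝ ![u, w]) : 0 < ⟪u, u⟫_ℝ * ⟪w, w⟫_ℝ - ⟪u, w⟫_ℝ ^ 2 := by
  have := (Matrix.posDef_gram_iff_linearIndependent (𝕜 := ℝ) (v := ![u, w])).2 h
  have := this.det_pos
  rw [Matrix.det_fin_two] at this
  simp [Matrix.gram, real_inner_comm u w] at this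
  simp only [real_inner_self_eq_norm_sq]
  nlinarith

/-- The quotient multiplying `Q` is the squared length of the orthogonal projection of `x` to the
plane of `u` and `w`. Only the angle between `x` and the plane matters. -/
theorem sectionalCurvature_conformal {ψ : EuclideanSpace ℝ (Fin n) → ℝ} (hψ : ContDiff ℝ 2 ψ)
    {P Q : ℝ} {x : EuclideanSpace ℝ (Fin n)}
    (hA : ∀ i j, schouten ψ x i j = P * δ i j + Q * (x i * x j))
    {u w : EuclideanSpace ℝ (Fin n)} (h : LinearIndependent ℝ ![u, w]) :
    sectionalCurvature (conformal ψ) x u w = - (2 * P + Q * (⟪x, u⟫_ℝ ^ 2 * ⟪w, w⟫_ℝ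
      + ⟪x, w⟫_ℝ ^ 2 * ⟪u, u⟫_ℝ - 2 * ⟪x, u⟫_ℝ * ⟪x, w⟫_ℝ * ⟪u, w⟫_ℝ) /
      (⟪u, u⟫_ℝ * ⟪w, w⟫_ℝ - ⟪u, w⟫_ℝ ^ 2)) / Real.exp (2 * ψ x) := by
  have hpos := inner_mul_inner_sub_sq_pos h
  obtain ⟨d, hd⟩ : ∃ d, d = ⟪u, u⟫_ℝ * ⟪w, w⟫_ℝ - ⟪u, w⟫_ℝ ^ 2 := ⟨_, rfl⟩
  rw [← hd] at hpos
  rw [sectionalCurvature, curv_conformal hψ hA]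
  simp only [pair_conformal, inner_add_left, inner_sub_left, inner_smul_left, real_inner_comm u w]
  simp only [RCLike.conj_to_real]
  have e := (Real.exp_pos (2 * ψ x)).ne'
  rw [show Real.exp (2 * ψ x) * ⟪u, u⟫_ℝ * (Real.exp (2 * ψ x) * ⟪w, w⟫_ℝ) -
    (Real.exp (2 * ψ x) * ⟪u, w⟫_ℝ) ^ 2 = Real.exp (2 * ψ x) ^ 2 *
      d by rw [hd]; ring, ← hd]
  have := hpos.ne'
  field_simp
  rw [hd]
  ring

end CoordMetric

/-! ### Asymptotics of the damped ODE on the cylinder. -/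

/-- Barbalat's lemma, for a function whose derivative is Lipschitz on a half-line. -/
theorem tendsto_deriv_zero_of_bounded_second_deriv {f f₁ f₂ : ℝ → ℝ} {s₀ K L : ℝ}
    (h₁ : ∀ s, HasDerivAt f (f₁ s) s) (h₂ : ∀ s, HasDerivAt f₁ (f₂ s) s)
    (hK : ∀ s, s₀ ≤ s → |f₂ s| ≤ K) (hf : Tendsto f atTop (𝓝 L)) :
    Tendsto f₁ atTop (𝓝 0) := by
  rw [Metric.tendsto_atTop]
  intro ε hε
  have hK0 : 0 ≤ K := (abs_nonneg _).trans (hK s₀ le_rfl)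
  -- Over a window of length `h` the function `f₁` varies by at most `K * h ≤ ε / 2`; the tolerance
  -- `ε * h / 8` on `f` below keeps its mean slope there within `ε / 4`.
  set h : ℝ := ε / (2 * (K + 1)) with hh
  have hpos : 0 < h := by positivity
  have hKh : K * h ≤ ε / 2 := by
    rw [hh, mul_div_assoc', div_le_div_iff₀ (by positivity) (by positivity)]
    nlinarith
  obtain ⟨N, hN⟩ := Metric.tendsto_atTop.1 hf (ε * h / 8) (by positivity)
  refine ⟨max N s₀, fun s hs => ?_⟩
  have hsN : N ≤ s := (le_max_left _ _).trans hs
  have hs0 : s₀ ≤ s := (le_max_right _ _).trans hs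
  obtain ⟨ξ, ⟨hξ1, hξ2⟩, hξ⟩ := exists_hasDerivAt_eq_slope f f₁ (show s < s + h by linarith)
    (fun x _ => (h₁ x).continuousAt.continuousWithinAt) (fun x _ => h₁ x)
  obtain ⟨ζ, ⟨hζ1, hζ2⟩, hζ⟩ := exists_hasDerivAt_eq_slope f₁ f₂ hξ1
    (fun x _ => (h₂ x).continuousAt.continuousWithinAt) (fun x _ => h₂ x)
  have e1 := hN s hsN
  have e2 := hN (s + h) (by linarith)
  rw [Real.dist_eq] at e1 e2
  have hslope : |f₁ ξ| ≤ ε / 4 := by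
    rw [hξ, add_sub_cancel_left, abs_div, abs_of_pos hpos, div_le_iff₀ hpos]
    have := abs_sub_le (f (s + h)) L (f s)
    rw [abs_sub_comm L] at this
    linarith
  have hdiff : |f₁ ξ - f₁ s| ≤ ε / 2 := by
    have : f₁ ξ - f₁ s = f₂ ζ * (ξ - s) := by
      rw [hζ, div_mul_cancel₀]; linarith
    rw [this, abs_mul, abs_of_pos (show 0 < ξ - s by linarith)]
    have := hK ζ (by linarith)
    calc |f₂ ζ| * (ξ - s) ≤ K * h := by
          apply mul_le_mul this (by linarith) (by linarith) hK0
      _ ≤ _ := hKh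
  rw [Real.dist_eq, sub_zero]
  have := abs_sub_abs_le_abs_sub (f₁ s) (f₁ ξ)
  rw [abs_sub_comm] at this
  linarith

/-- Damped motion in a potential well: a trajectory of
`(N - 1) (y'' + (N - 2) / 2 * (y' ^ 2 - 1)) + exp (2 y) (ρ / 2 + β y') = 0` that emanates from the
end of the cylinder at `-∞` converges to the equilibrium. -/
theorem cylinder_ode_tendsto {N ρ β : ℝ} (hN : 2 < N) (hρ : 0 < ρ) (hβ : 0 < β)
    {y y₁ y₂ : ℝ → ℝ} (h₁ : ∀ s, HasDerivAt y (y₁ s) s) (h₂ : ∀ s, HasDerivAt y₁ (y₂ s) s)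
    (hode : ∀ s, (N - 1) * (y₂ s + (N - 2) / 2 * (y₁ s ^ 2 - 1)) +
      Real.exp (2 * y s) * (ρ / 2 + β * y₁ s) = 0)
    (hbot : Tendsto y atBot atBot) (hbot₁ : Tendsto y₁ atBot (𝓝 1)) :
    Tendsto y₁ atTop (𝓝 0) ∧ Tendsto y₂ atTop (𝓝 0) ∧
      Tendsto (fun s => Real.exp (2 * y s)) atTop (𝓝 ((N - 1) * (N - 2) / ρ)) := by
  have hexp : ∀ c s, HasDerivAt (fun t => Real.exp (c * y t)) (Real.exp (c * y s) * (c * y₁ s)) s :=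
    fun c s => ((h₁ s).const_mul c).exp
  -- Multiplying the ODE by `y' exp ((N - 2) y)` makes every term except the damping an exact
  -- derivative, so `E' = -β exp (N y) y'²`.
  set E : ℝ → ℝ := fun s => Real.exp ((N - 2) * y s) *
    ((N - 1) * (y₁ s ^ 2 - 1) / 2 + ρ / (2 * N) * Real.exp (2 * y s)) with hE
  set E₁ : ℝ → ℝ := fun s => -(β * (Real.exp (N * y s) * y₁ s ^ 2)) with hE₁
  have hE' : ∀ s, HasDerivAt E (E₁ s) s := by
    intro s
    have key := (hexp (N - 2) s).mul (((((h₂ s).pow 2).sub_const 1).const_mul (N - 1)).div_const 2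
      |>.add ((hexp 2 s).const_mul (ρ / (2 * N))))
    refine key.congr_deriv ?_
    have e : Real.exp (N * y s) = Real.exp ((N - 2) * y s) * Real.exp (2 * y s) := by
      rw [← Real.exp_add]; ring_nf
    have hN0 : N ≠ 0 := by linarith
    simp only [hE₁, e, Pi.add_apply, Pi.pow_apply]
    have hy2 : (N - 1) * y₂ s = -((N - 1) * ((N - 2) / 2 * (y₁ s ^ 2 - 1)) +
      Real.exp (2 * y s) * (ρ / 2 + β * y₁ s)) := by linarith [hode s]
    field_simp
    linear_combination (2 * y₁ s * N ) * hy2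
  have hanti : Antitone E := antitone_of_hasDerivAt_nonpos hE' (fun s => by
    simp only [hE₁]; have := Real.exp_pos (N * y s); simp; positivity)
  have hE0 : Tendsto E atBot (𝓝 0) := by
    have t : ∀ c : ℝ, 0 < c → Tendsto (fun s => Real.exp (c * y s)) atBot (𝓝 0) := fun c hc =>
      Real.tendsto_exp_atBot.comp (hbot.const_mul_atBot hc)
    have := (t (N - 2) (by linarith)).mul ((((((hbot₁.pow 2).sub_const 1).const_mul (N - 1)).div_const 2)).add
      ((t 2 two_pos).const_mul (ρ / (2 * N))))
    simpa [hE] using this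
  have hEle : ∀ s, E s ≤ 0 := fun s => hanti.ge_of_tendsto hE0 s
  -- Near `-∞` the velocity is close to `1`, so the dissipation is strict there.
  obtain ⟨s₀, hs₀⟩ : ∃ s₀, E s₀ < 0 := by
    obtain ⟨b, hb⟩ := eventually_atBot.1 (hbot₁.eventually (lt_mem_nhds zero_lt_one))
    refine ⟨b, lt_of_lt_of_le ?_ (hEle (b - 1))⟩
    refine strictAntiOn_of_deriv_neg (convex_Iic b)
      (fun x _ => (hE' x).continuousAt.continuousWithinAt) (fun x hx => ?_) (by simp) (by simp)
      (by linarith)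
    rw [interior_Iic] at hx
    rw [(hE' x).deriv, hE₁]
    have := hb x (le_of_lt hx)
    have := Real.exp_pos (N * y x)
    simp only [Left.neg_neg_iff]
    positivity
  -- Nonpositive energy bounds both `|y'|` and, from above, `y`.
  have hfac : ∀ s, (N - 1) * (y₁ s ^ 2 - 1) / 2 + ρ / (2 * N) * Real.exp (2 * y s) ≤ 0 := fun s =>
    nonpos_of_mul_nonpos_right (hEle s) (Real.exp_pos _)
  have hy1 : ∀ s, y₁ s ^ 2 ≤ 1 := by
    intro s
    have h := hfac s
    have : 0 ≤ ρ / (2 * N) * Real.exp (2 * y s) := by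
      have : 0 < N := by linarith
      positivity
    nlinarith
  have hy1' : ∀ s, |y₁ s| ≤ 1 := fun s => abs_le_one_iff_mul_self_le_one.2 (by nlinarith [hy1 s])
  set M : ℝ := N * (N - 1) / ρ with hM
  have hyM : ∀ s, Real.exp (2 * y s) ≤ M := by
    intro s
    have h := hfac s
    have h2 : ρ / (2 * N) * Real.exp (2 * y s) ≤ (N - 1) / 2 := by nlinarith [sq_nonneg (y₁ s)]
    have hN0 : 0 < N := by linarith
    rw [hM, le_div_iff₀ hρ]
    rw [div_mul_eq_mul_div, div_le_div_iff₀ (by positivity) two_pos] at h2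
    nlinarith
  have hM0 : 0 < M := by have : 0 < N - 1 := by linarith
                         have : 0 < N := by linarith
                         positivity
  -- The only negative term of `E` is `-(N - 1) / 2 * exp ((N - 2) y)`. Since `E ≤ E s₀ < 0` after
  -- `s₀`, it cannot become small, which bounds `y` from below.
  obtain ⟨δ, hδ, hyδ⟩ : ∃ δ > 0, ∀ s, s₀ ≤ s → δ ≤ Real.exp ((N - 2) * y s) := by
    refine ⟨-E s₀ * 2 / (N - 1), div_pos (by linarith) (by linarith), fun s hs => ?_⟩
    rw [div_le_iff₀ (by linarith)]
    have h := hanti hs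
    have hp := Real.exp_pos ((N - 2) * y s)
    have hq : 0 ≤ Real.exp ((N - 2) * y s) * ((N - 1) * y₁ s ^ 2 / 2 +
      ρ / (2 * N) * Real.exp (2 * y s)) := by
      have : 0 < N := by linarith
      have : 0 < N - 1 := by linarith
      positivity
    have : E s = Real.exp ((N - 2) * y s) * ((N - 1) * y₁ s ^ 2 / 2 +
      ρ / (2 * N) * Real.exp (2 * y s)) - Real.exp ((N - 2) * y s) * (N - 1) / 2 := by
      simp only [hE]; ring
    linarith
  obtain ⟨D, hD, hyD⟩ : ∃ D > 0, ∀ s, s₀ ≤ s → D ≤ Real.exp (N * y s) := by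
    have hN2 : 0 < N - 2 := by linarith
    refine ⟨Real.exp (N * (Real.log δ / (N - 2))), Real.exp_pos _, fun s hs => ?_⟩
    apply Real.exp_le_exp.2
    apply mul_le_mul_of_nonneg_left _ (by linarith)
    rw [div_le_iff₀ hN2, mul_comm]
    exact (Real.log_le_iff_le_exp hδ).2 (hyδ s hs)
  obtain ⟨C, hC⟩ : ∃ C, ∀ s, |y₂ s| ≤ C := by
    refine ⟨(N - 2) / 2 + M * (ρ / 2 + β) / (N - 1), fun s => ?_⟩
    have hN1 : 0 < N - 1 := by linarith
    have e : y₂ s = (N - 2) / 2 * (1 - y₁ s ^ 2) -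
        Real.exp (2 * y s) * (ρ / 2 + β * y₁ s) / (N - 1) := by
      have := hode s
      field_simp
      linarith
    rw [e]
    refine (abs_sub _ _).trans (add_le_add ?_ ?_)
    · rw [abs_mul, abs_of_pos (by linarith : 0 < (N - 2) / 2)]
      have : |1 - y₁ s ^ 2| ≤ 1 := abs_le.2 ⟨by linarith [hy1 s], by linarith [sq_nonneg (y₁ s)]⟩
      exact mul_le_of_le_one_right (by linarith) this
    · rw [abs_div, abs_of_pos hN1, abs_mul, abs_of_pos (Real.exp_pos _)]
      gcongr
      · exact hyM s
      · refine (abs_add_le _ _).trans ?_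
        rw [abs_of_pos (half_pos hρ), abs_mul, abs_of_pos hβ]
        nlinarith [hy1' s]
  have hexpN : ∀ s, Real.exp (N * y s) ≤ Real.exp (N * (Real.log M / 2)) := fun s => by
    apply Real.exp_le_exp.2
    apply mul_le_mul_of_nonneg_left _ (by linarith)
    have := (Real.le_log_iff_exp_le hM0).2 (hyM s)
    linarith
  have hElim : ∃ L, Tendsto E atTop (𝓝 L) := by
    refine ⟨_, tendsto_atTop_ciInf hanti ⟨-((N - 1) / 2 * Real.exp ((N - 2) * (Real.log M / 2))), ?_⟩⟩
    rintro _ ⟨s, rfl⟩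
    have hp : Real.exp ((N - 2) * y s) ≤ Real.exp ((N - 2) * (Real.log M / 2)) := by
      apply Real.exp_le_exp.2
      apply mul_le_mul_of_nonneg_left _ (by linarith)
      have := (Real.le_log_iff_exp_le hM0).2 (hyM s)
      linarith
    have hq : 0 ≤ Real.exp ((N - 2) * y s) * ((N - 1) * y₁ s ^ 2 / 2 +
      ρ / (2 * N) * Real.exp (2 * y s)) := by
      have : 0 < N := by linarith
      have : 0 < N - 1 := by linarith
      positivity
    have : E s = Real.exp ((N - 2) * y s) * ((N - 1) * y₁ s ^ 2 / 2 +
      ρ / (2 * N) * Real.exp (2 * y s)) - (N - 1) / 2 * Real.exp ((N - 2) * y s) := by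
      simp only [hE]; ring
    have := mul_le_mul_of_nonneg_left hp (by linarith : 0 ≤ (N - 1) / 2)
    linarith
  obtain ⟨L, hL⟩ := hElim
  -- Barbalat's lemma applied to `E` gives `E' → 0`; as `exp (N y) ≥ D`, this forces `y'² → 0`.
  have hy1lim : Tendsto y₁ atTop (𝓝 0) := by
    have hE₂ : ∀ s, HasDerivAt E₁ (-(β * (Real.exp (N * y s) * (N * y₁ s) * y₁ s ^ 2 +
        Real.exp (N * y s) * (2 * y₁ s * y₂ s)))) s := fun s => by
      refine ((((hexp N s).mul ((h₂ s).pow 2)).const_mul β).neg).congr_deriv ?_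
      simp
    have hE₁lim := tendsto_deriv_zero_of_bounded_second_deriv hE' hE₂ (s₀ := s₀)
      (K := β * (Real.exp (N * (Real.log M / 2)) * (N + 2 * C))) (fun s _ => by
        have e : Real.exp (N * y s) * (N * y₁ s) * y₁ s ^ 2 +
          Real.exp (N * y s) * (2 * y₁ s * y₂ s) =
          Real.exp (N * y s) * (N * y₁ s ^ 3 + 2 * (y₁ s * y₂ s)) := by ring
        rw [abs_neg, e, abs_mul, abs_of_pos hβ, abs_mul, abs_of_pos (Real.exp_pos _)]
        apply mul_le_mul_of_nonneg_left _ hβ.le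
        apply mul_le_mul (hexpN s) _ (abs_nonneg _) (Real.exp_pos _).le
        refine (abs_add_le _ _).trans (add_le_add ?_ ?_)
        · rw [abs_mul, abs_of_pos (by linarith : 0 < N), abs_pow]
          exact mul_le_of_le_one_right (by linarith) (pow_le_one₀ (abs_nonneg _) (hy1' s))
        · rw [abs_mul, abs_mul, abs_two]
          have := mul_le_mul (hy1' s) (hC s) (abs_nonneg _) zero_le_one
          linarith) hL
    have hsq : Tendsto (fun s => y₁ s ^ 2) atTop (𝓝 0) := by
      have hb := hE₁lim.neg.div_const (β * D)
      simp only [neg_zero, zero_div] at hb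
      refine squeeze_zero' (Eventually.of_forall fun s => sq_nonneg _) ?_ hb
      filter_upwards [eventually_ge_atTop s₀] with s hs
      rw [le_div_iff₀ (by positivity), hE₁]
      have := mul_le_mul_of_nonneg_left (hyD s hs) (mul_nonneg hβ.le (sq_nonneg (y₁ s)))
      linarith
    have := hsq.sqrt
    simp only [Real.sqrt_sq_eq_abs, Real.sqrt_zero] at this
    exact (tendsto_zero_iff_abs_tendsto_zero _).2 this
  have hN1 : 0 < N - 1 := by linarith
  have hy2fun : y₂ = fun s => (N - 2) / 2 * (1 - y₁ s ^ 2) -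
      Real.exp (2 * y s) * (ρ / 2 + β * y₁ s) / (N - 1) := by
    ext s
    have := hode s
    field_simp
    linarith
  -- A third derivative is not assumed: the ODE expresses `y₂` through `y` and `y₁`, both
  -- differentiable.
  have hy3 : ∀ s, HasDerivAt y₂ (-((N - 2) * (y₁ s * y₂ s)) -
      Real.exp (2 * y s) * (y₁ s * (ρ + 2 * β * y₁ s) + β * y₂ s) / (N - 1)) s := by
    intro s
    have key := ((((h₂ s).pow 2).const_sub 1).const_mul ((N - 2) / 2)).sub
      (((hexp 2 s).mul (((h₂ s).const_mul β).const_add (ρ / 2))).div_const (N - 1))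
    refine (key.congr_of_eventuallyEq (Eventually.of_forall (congrFun hy2fun))).congr_deriv ?_
    field_simp
    ring
  have hy2lim : Tendsto y₂ atTop (𝓝 0) := by
    refine tendsto_deriv_zero_of_bounded_second_deriv h₂ hy3 (s₀ := s₀)
      (K := (N - 2) * C + M * ((ρ + 2 * β) + β * C) / (N - 1)) (fun s _ => ?_) hy1lim
    have hyy : |y₁ s * y₂ s| ≤ C := by
      rw [abs_mul]
      have := mul_le_mul (hy1' s) (hC s) (abs_nonneg _) zero_le_one
      linarith
    refine (abs_sub _ _).trans (add_le_add ?_ ?_)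
    · rw [abs_neg, abs_mul, abs_of_pos (by linarith : 0 < N - 2)]
      exact mul_le_mul_of_nonneg_left hyy (by linarith)
    · rw [abs_div, abs_of_pos hN1, abs_mul, abs_of_pos (Real.exp_pos _)]
      apply div_le_div_of_nonneg_right _ hN1.le
      refine mul_le_mul (hyM s) ?_ (abs_nonneg _) hM0.le
      refine (abs_add_le _ _).trans (add_le_add ?_ ?_)
      · rw [abs_mul]
        refine (mul_le_of_le_one_left (abs_nonneg _) (hy1' s)).trans ?_
        refine (abs_add_le _ _).trans ?_
        rw [abs_of_pos hρ, abs_mul, abs_of_pos (by linarith : 0 < 2 * β)]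
        nlinarith [hy1' s]
      · rw [abs_mul, abs_of_pos hβ]
        exact mul_le_mul_of_nonneg_left (hC s) hβ.le
  refine ⟨hy1lim, hy2lim, ?_⟩
  have hden : Tendsto (fun s => ρ / 2 + β * y₁ s) atTop (𝓝 (ρ / 2)) := by
    simpa using (hy1lim.const_mul β).const_add (ρ / 2)
  have hnum : Tendsto (fun s => -((N - 1) * (y₂ s + (N - 2) / 2 * (y₁ s ^ 2 - 1)))) atTop
      (𝓝 (-((N - 1) * (0 + (N - 2) / 2 * (0 ^ 2 - 1))))) :=
    ((hy2lim.add (((hy1lim.pow 2).sub_const 1).const_mul ((N - 2) / 2))).const_mul (N - 1)).neg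
  have hq := hnum.div hden (half_pos hρ).ne'
  have e : -((N - 1) * (0 + (N - 2) / 2 * (0 ^ 2 - 1))) / (ρ / 2) = (N - 1) * (N - 2) / ρ := by
    field_simp
    ring
  rw [e] at hq
  -- The ODE solved for `exp (2y)`, valid once `ρ / 2 + β y'` is positive.
  refine hq.congr' ?_
  filter_upwards [hden.eventually (lt_mem_nhds (half_pos hρ))] with s hs
  simp only [Pi.div_apply]
  rw [div_eq_iff hs.ne']
  linarith [hode s]

/-! ### Radial functions in the variable `log ‖x‖`. -/

namespace CoordMetric

variable {n : ℕ}

/-- The Kronecker delta. -/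
local notation "δ" => (1 : Matrix (Fin n) (Fin n) ℝ)

theorem hasFDerivAt_radial {G : ℝ → ℝ} {G' : ℝ} {x : EuclideanSpace ℝ (Fin n)} (hx : x ≠ 0)
    (hG : HasDerivAt G G' (Real.log ‖x‖)) :
    HasFDerivAt (fun y : EuclideanSpace ℝ (Fin n) => G (Real.log ‖y‖))
      ((G' / ‖x‖ ^ 2) • innerSL ℝ x) x := by
  have hx' : ‖x‖ ≠ 0 := norm_ne_zero_iff.2 hx
  have h1 : HasFDerivAt (fun y : EuclideanSpace ℝ (Fin n) => Real.log ‖y‖)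
      ((1 / ‖x‖ ^ 2) • innerSL ℝ x) x := by
    have h := (((hasStrictFDerivAt_norm_sq x).hasFDerivAt.log (pow_ne_zero 2 hx')).const_mul
      (1 / 2 : ℝ))
    refine (h.congr_of_eventuallyEq (Eventually.of_forall fun y => ?_)).congr_fderiv ?_
    · simp only [Real.log_pow]; push_cast; ring
    · ext z
      simp
      ring
  refine (hG.comp_hasFDerivAt x h1).congr_fderiv ?_
  rw [smul_smul, mul_one_div]

theorem exp_two_mul_log {r : ℝ} (hr : 0 < r) : Real.exp (2 * Real.log r) = r ^ 2 := by
  rw [two_mul, Real.exp_add, Real.exp_log hr, sq]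

theorem eventually_ne_zero {x : EuclideanSpace ℝ (Fin n)} (hx : x ≠ 0) : ∀ᶠ y in 𝓝 x, y ≠ 0 :=
  isOpen_ne.mem_nhds hx

theorem pd_radial {f : EuclideanSpace ℝ (Fin n) → ℝ} {G G₁ : ℝ → ℝ}
    (hf : ∀ x, x ≠ 0 → f x = G (Real.log ‖x‖)) (h₁ : ∀ s, HasDerivAt G (G₁ s) s)
    {x : EuclideanSpace ℝ (Fin n)} (hx : x ≠ 0) (i : Fin n) :
    pd i f x = G₁ (Real.log ‖x‖) / ‖x‖ ^ 2 * x i := by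
  rw [pd_congr ((eventually_ne_zero hx).mono hf), pd_eq_of_hasFDerivAt (hasFDerivAt_radial hx (h₁ _))]
  simp [EuclideanSpace.inner_single_right]

/-- Since `‖x‖⁻² = exp (-2 log ‖x‖)`, a first partial derivative is again a function of `log ‖x‖`
times a coordinate, and the product rule applies. -/
theorem pd_pd_radial {f : EuclideanSpace ℝ (Fin n) → ℝ} {G G₁ G₂ : ℝ → ℝ}
    (hf : ∀ x, x ≠ 0 → f x = G (Real.log ‖x‖)) (h₁ : ∀ s, HasDerivAt G (G₁ s) s)
    (h₂ : ∀ s, HasDerivAt G₁ (G₂ s) s) {x : EuclideanSpace ℝ (Fin n)} (hx : x ≠ 0) (i j : Fin n) :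
    pd i (pd j f) x = G₁ (Real.log ‖x‖) / ‖x‖ ^ 2 * δ i j +
      (G₂ (Real.log ‖x‖) - 2 * G₁ (Real.log ‖x‖)) / ‖x‖ ^ 4 * (x i * x j) := by
  have he : ∀ y : EuclideanSpace ℝ (Fin n), y ≠ 0 →
      Real.exp (-2 * Real.log ‖y‖) = (‖y‖ ^ 2)⁻¹ := fun y hy => by
    rw [neg_mul, Real.exp_neg, exp_two_mul_log (norm_pos_iff.2 hy)]
  have hK : ∀ s, HasDerivAt (fun t => G₁ t * Real.exp (-2 * t))
      ((G₂ s - 2 * G₁ s) * Real.exp (-2 * s)) s := fun s => by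
    refine ((h₂ s).mul (((hasDerivAt_id s).const_mul (-2)).exp)).congr_deriv ?_
    simp
    ring
  have hpd : ∀ y, y ≠ 0 → pd j f y =
      (fun t => G₁ t * Real.exp (-2 * t)) (Real.log ‖y‖) * (EuclideanSpace.proj j : _ →L[ℝ] ℝ) y :=
    fun y hy => by
      simp only [pd_radial hf h₁ hy, he y hy]
      simp [div_eq_mul_inv]
  rw [pd_congr ((eventually_ne_zero hx).mono hpd)]
  refine (pd_eq_of_hasFDerivAt ((hasFDerivAt_radial hx (hK _)).mul
      (EuclideanSpace.proj j : EuclideanSpace ℝ (Fin n) →L[ℝ] ℝ).hasFDerivAt) i).trans ?_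
  have hx' : ‖x‖ ≠ 0 := norm_ne_zero_iff.2 hx
  rw [he x hx]
  simp [EuclideanSpace.inner_single_right, Matrix.one_apply, eq_comm]
  field_simp

theorem laplacian_radial {f : EuclideanSpace ℝ (Fin n) → ℝ} {G G₁ G₂ : ℝ → ℝ}
    (hC : ContDiff ℝ 2 f)
    (hf : ∀ x, x ≠ 0 → f x = G (Real.log ‖x‖)) (h₁ : ∀ s, HasDerivAt G (G₁ s) s)
    (h₂ : ∀ s, HasDerivAt G₁ (G₂ s) s) {x : EuclideanSpace ℝ (Fin n)} (hx : x ≠ 0) :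
    (Δ f) x = (G₂ (Real.log ‖x‖) + ((n : ℝ) - 2) * G₁ (Real.log ‖x‖)) / ‖x‖ ^ 2 := by
  have hx' : ‖x‖ ≠ 0 := norm_ne_zero_iff.2 hx
  rw [laplacian_eq_sum_pd hC.contDiffAt]
  simp only [pd_pd_radial hf h₁ h₂ hx, Finset.sum_add_distrib, ← Finset.mul_sum, ← sq,
    ← EuclideanSpace.real_norm_sq_eq]
  simp
  field_simp
  ring

theorem schouten_radial {ψ : EuclideanSpace ℝ (Fin n) → ℝ} {G G₁ G₂ : ℝ → ℝ}
    (hf : ∀ x, x ≠ 0 → ψ x = G (Real.log ‖x‖)) (h₁ : ∀ s, HasDerivAt G (G₁ s) s)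
    (h₂ : ∀ s, HasDerivAt G₁ (G₂ s) s) {x : EuclideanSpace ℝ (Fin n)} (hx : x ≠ 0) (i j : Fin n) :
    schouten ψ x i j =
      (G₁ (Real.log ‖x‖) + G₁ (Real.log ‖x‖) ^ 2 / 2) / ‖x‖ ^ 2 * δ i j +
      (G₂ (Real.log ‖x‖) - 2 * G₁ (Real.log ‖x‖) - G₁ (Real.log ‖x‖) ^ 2) / ‖x‖ ^ 4 * (x i * x j) := by
  have hx' : ‖x‖ ≠ 0 := norm_ne_zero_iff.2 hx
  simp only [schouten, pd_pd_radial hf h₁ h₂ hx, pd_radial hf h₁ hx, mul_pow, ← Finset.mul_sum,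
    ← EuclideanSpace.real_norm_sq_eq]
  field_simp
  ring

theorem scalarCurvature_radial {ψ : EuclideanSpace ℝ (Fin n) → ℝ} (hψ : ContDiff ℝ 2 ψ)
    {G G₁ G₂ : ℝ → ℝ}
    (hf : ∀ x, x ≠ 0 → ψ x = G (Real.log ‖x‖)) (h₁ : ∀ s, HasDerivAt G (G₁ s) s)
    (h₂ : ∀ s, HasDerivAt G₁ (G₂ s) s) {x : EuclideanSpace ℝ (Fin n)} (hx : x ≠ 0) :
    scalarCurvature (conformal ψ) x = -2 * ((n : ℝ) - 1) *
      (((n : ℝ) - 2) * (G₁ (Real.log ‖x‖) + G₁ (Real.log ‖x‖) ^ 2 / 2) + G₂ (Real.log ‖x‖)) /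
      (‖x‖ ^ 2 * Real.exp (2 * ψ x)) := by
  have hx' : ‖x‖ ≠ 0 := norm_ne_zero_iff.2 hx
  rw [scalarCurvature_conformal hψ]
  simp only [schouten_radial hf h₁ h₂ hx, Finset.sum_add_distrib, ← Finset.mul_sum, ← sq,
    ← EuclideanSpace.real_norm_sq_eq]
  have := (Real.exp_pos (2 * ψ x)).ne'
  simp
  field_simp
  ring

/-- The plane contains `x`, so the projection is `x` itself, and in `2P + Q‖x‖²` all first-order
terms cancel. -/
theorem sectionalCurvature_radial_plane {ψ : EuclideanSpace ℝ (Fin n) → ℝ} (hψ : ContDiff ℝ 2 ψ)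
    {G G₁ G₂ : ℝ → ℝ}
    (hf : ∀ x, x ≠ 0 → ψ x = G (Real.log ‖x‖)) (h₁ : ∀ s, HasDerivAt G (G₁ s) s)
    (h₂ : ∀ s, HasDerivAt G₁ (G₂ s) s) {x u : EuclideanSpace ℝ (Fin n)}
    (hxu : LinearIndependent ℝ ![x, u]) :
    sectionalCurvature (conformal ψ) x x u =
      -G₂ (Real.log ‖x‖) / (‖x‖ ^ 2 * Real.exp (2 * ψ x)) := by
  have hx : x ≠ 0 := hxu.ne_zero 0
  have hx' : ‖x‖ ≠ 0 := norm_ne_zero_iff.2 hx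
  rw [sectionalCurvature_conformal hψ (schouten_radial hf h₁ h₂ hx) hxu]
  obtain ⟨d, hd⟩ : ∃ d, d = ⟪x, x⟫_ℝ * ⟪u, u⟫_ℝ - ⟪x, u⟫_ℝ ^ 2 := ⟨_, rfl⟩
  have hpos := inner_mul_inner_sub_sq_pos hxu
  rw [← hd] at hpos ⊢
  rw [show ⟪x, x⟫_ℝ ^ 2 * ⟪u, u⟫_ℝ + ⟪x, u⟫_ℝ ^ 2 * ⟪x, x⟫_ℝ - 2 * ⟪x, x⟫_ℝ * ⟪x, u⟫_ℝ * ⟪x, u⟫_ℝ =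
    ‖x‖ ^ 2 * d by rw [hd, real_inner_self_eq_norm_sq]; ring, mul_div_assoc, mul_div_cancel_right₀ _ hpos.ne']
  have := (Real.exp_pos (2 * ψ x)).ne'
  field_simp
  ring

theorem sectionalCurvature_tangent_plane {ψ : EuclideanSpace ℝ (Fin n) → ℝ} (hψ : ContDiff ℝ 2 ψ)
    {G G₁ G₂ : ℝ → ℝ}
    (hf : ∀ x, x ≠ 0 → ψ x = G (Real.log ‖x‖)) (h₁ : ∀ s, HasDerivAt G (G₁ s) s)
    (h₂ : ∀ s, HasDerivAt G₁ (G₂ s) s) {x u w : EuclideanSpace ℝ (Fin n)} (hx : x ≠ 0)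
    (hu : ⟪x, u⟫_ℝ = 0) (hw : ⟪x, w⟫_ℝ = 0) (huw : LinearIndependent ℝ ![u, w]) :
    sectionalCurvature (conformal ψ) x u w =
      -(2 * G₁ (Real.log ‖x‖) + G₁ (Real.log ‖x‖) ^ 2) / (‖x‖ ^ 2 * Real.exp (2 * ψ x)) := by
  have hx' : ‖x‖ ≠ 0 := norm_ne_zero_iff.2 hx
  rw [sectionalCurvature_conformal hψ (schouten_radial hf h₁ h₂ hx) huw, hu, hw]
  have := (Real.exp_pos (2 * ψ x)).ne'
  simp
  field_simp
  ring

end CoordMetric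

/-! ### Reduction of the elliptic equation to the ODE. -/

open CoordMetric

namespace IsEllipticSolution

variable {n : ℕ} {m α β ρ : ℝ} {v : EuclideanSpace ℝ (Fin n) → ℝ}

theorem contDiff_log (hv : IsEllipticSolution n m α β v) :
    ContDiff ℝ 2 (fun x => 2 / ((n : ℝ) + 2) * Real.log (v x)) :=
  contDiff_const.mul (hv.contDiff.log fun x => (hv.pos x).ne')

theorem yamabe_eq_conformal (hv : IsEllipticSolution n m α β v) :
    yamabe v = conformal (fun x => 2 / ((n : ℝ) + 2) * Real.log (v x)) := by
  funext x
  rw [yamabe, conformal, Real.rpow_def_of_pos (hv.pos x)]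
  congr 2
  ring

/-- The equation in the logarithmic radial variable. -/
theorem radial_ode (hn : 3 ≤ n) (hm : m = ((n : ℝ) - 2) / ((n : ℝ) + 2))
    (hα : α = (2 * β + ρ) / (1 - m)) (hv : IsEllipticSolution n m α β v) {η η₁ η₂ : ℝ → ℝ}
    (hη : ∀ x, x ≠ 0 → 2 / ((n : ℝ) + 2) * Real.log (v x) = η (Real.log ‖x‖))
    (h₁ : ∀ s, HasDerivAt η (η₁ s) s) (h₂ : ∀ s, HasDerivAt η₁ (η₂ s) s)
    {x : EuclideanSpace ℝ (Fin n)} (hx : x ≠ 0) {s : ℝ} (hs : Real.log ‖x‖ = s) :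
    ((n : ℝ) - 1) * (η₂ s + ((n : ℝ) - 2) / 2 * ((1 + η₁ s) ^ 2 - 1)) +
      Real.exp (2 * (s + η s)) * (ρ / 2 + β * (1 + η₁ s)) = 0 := by
  have hn' : (3 : ℝ) ≤ n := by exact_mod_cast hn
  have hn0 : (n : ℝ) - 2 ≠ 0 := by linarith
  have hn2 : (n : ℝ) + 2 ≠ 0 := by linarith
  obtain ⟨a, ha⟩ : ∃ a : ℝ, a = ((n : ℝ) - 2) / 2 := ⟨_, rfl⟩
  have hexp : ∀ c s, HasDerivAt (fun t => Real.exp (c * η t)) (c * η₁ s * Real.exp (c * η s)) s :=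
    fun c s => ((h₁ s).const_mul c).exp.congr_deriv (mul_comm _ _)
  have hvr : ∀ y, y ≠ 0 → v y = Real.exp (((n : ℝ) + 2) / 2 * η (Real.log ‖y‖)) := fun y hy => by
    rw [← hη y hy, ← mul_assoc, div_mul_div_cancel₀ two_ne_zero, div_self hn2, one_mul,
      Real.exp_log (hv.pos y)]
  have hvm : ∀ y, y ≠ 0 → v y ^ m = Real.exp (a * η (Real.log ‖y‖)) := fun y hy => by
    rw [Real.rpow_def_of_pos (hv.pos y), hvr y hy, Real.log_exp, hm, ha]
    congr 1
    field_simp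
  have hC : ContDiff ℝ 2 (fun y => v y ^ m) :=
    hv.contDiff.rpow_const_of_ne fun y => (hv.pos y).ne'
  have hlap := laplacian_radial hC hvm (hexp a)
    (fun s => ((h₂ s).const_mul a).mul (hexp a s)) hx
  have hgrad : ⟪x, ∇ v x⟫_ℝ = ((n : ℝ) + 2) / 2 * η₁ s * v x := by
    have hd := (hasFDerivAt_radial hx (hexp (((n : ℝ) + 2) / 2) (Real.log ‖x‖))).congr_of_eventuallyEq
      ((eventually_ne_zero hx).mono hvr)
    rw [real_inner_comm, inner_gradient_left, hd.fderiv, hvr x hx]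
    have hx' : ‖x‖ ≠ 0 := norm_ne_zero_iff.2 hx
    simp [hs]
    field_simp
  have heq := hv.eqn x
  have hnorm : ‖x‖ ^ 2 = Real.exp (2 * s) := by
    rw [← hs, exp_two_mul_log (norm_pos_iff.2 hx)]
  -- This is `v = v ^ m * v ^ (1 - m)`, with `v ^ (1 - m)` the conformal factor.
  have hG : Real.exp (((n : ℝ) + 2) / 2 * η s) = Real.exp (a * η s) * Real.exp (2 * η s) := by
    rw [← Real.exp_add, ha]; ring_nf
  rw [hlap, hgrad, hnorm, hvr x hx, hs, hG] at heq
  have h1m : 1 - m = 4 / ((n : ℝ) + 2) := by rw [hm]; field_simp; ring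
  rw [hα, h1m, hm] at heq
  have e1 := (Real.exp_pos (a * η s)).ne'
  have e2 := (Real.exp_pos (2 * s)).ne'
  rw [mul_add 2 s, Real.exp_add]
  generalize Real.exp (a * η s) = A at heq e1
  generalize Real.exp (2 * s) = B at heq e2
  -- The elliptic equation is the ODE times the nonzero factor `(n + 2) / 2 * v ^ m / r²`.
  refine (mul_eq_zero.1 (Eq.trans ?_ heq)).resolve_left
    (show ((n : ℝ) + 2) / 2 * A / B ≠ 0 by positivity)
  rw [ha]
  field_simp
  ring

end IsEllipticSolution

/-! ### The limits of the logarithmic slope and of the curvatures. -/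

theorem theorem1p5 (n : ℕ) (hn : 3 ≤ n) (m α β ρ : ℝ)
    (hm : m = ((n : ℝ) - 2) / ((n : ℝ) + 2))
    (hρ : 0 < ρ) (hβ : ρ / 2 < β) (hα : α = (2 * β + ρ) / (1 - m))
    (v : EuclideanSpace ℝ (Fin n) → ℝ) (hv : IsEllipticSolution n m α β v)
    (V : ℝ → ℝ) (hV : ∀ x, v x = V ‖x‖) :
    Tendsto (fun r => r * deriv V r / V r) atTop (𝓝 (-2 / (1 - m))) ∧
    (∃ R : ℝ → ℝ, (∀ x, CoordMetric.scalarCurvature (CoordMetric.yamabe v) x = R ‖x‖) ∧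
      Tendsto R atTop (𝓝 ρ)) ∧
    (∃ K₀ : ℝ → ℝ,
      (∀ x u : EuclideanSpace ℝ (Fin n), LinearIndependent ℝ ![x, u] →
        CoordMetric.sectionalCurvature (CoordMetric.yamabe v) x x u = K₀ ‖x‖) ∧
      Tendsto K₀ atTop (𝓝 0)) ∧
    (∃ K₁ : ℝ → ℝ,
      (∀ x u w : EuclideanSpace ℝ (Fin n), x ≠ 0 → ⟪x, u⟫_ℝ = 0 → ⟪x, w⟫_ℝ = 0 →
        LinearIndependent ℝ ![u, w] →
        CoordMetric.sectionalCurvature (CoordMetric.yamabe v) x u w = K₁ ‖x‖) ∧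
      Tendsto K₁ atTop (𝓝 (ρ / (((n : ℝ) - 1) * ((n : ℝ) - 2))))) := by
  have hn' : (3 : ℝ) ≤ n := by exact_mod_cast hn
  have hn1 : (n : ℝ) - 1 ≠ 0 := by linarith
  have hn0 : (n : ℝ) - 2 ≠ 0 := by linarith
  have hn2 : (n : ℝ) + 2 ≠ 0 := by linarith
  have h1m : 1 - m = 4 / ((n : ℝ) + 2) := by rw [hm]; field_simp; ring
  set ψ : EuclideanSpace ℝ (Fin n) → ℝ := fun x => 2 / ((n : ℝ) + 2) * Real.log (v x) with hψdef
  have hψ : ContDiff ℝ 2 ψ := hv.contDiff_log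
  set e : EuclideanSpace ℝ (Fin n) := EuclideanSpace.single ⟨0, by omega⟩ 1 with he
  have hne : ‖e‖ = 1 := by simp [he]
  -- Restricting `ψ` to a ray, rather than using `V`, makes `η` inherit its regularity from `v`.
  set η : ℝ → ℝ := fun s => ψ (Real.exp s • e) with hηdef
  have hηC : ContDiff ℝ 2 η := hψ.comp (Real.contDiff_exp.smul contDiff_const)
  have hη : ∀ x, x ≠ 0 → ψ x = η (Real.log ‖x‖) := fun x hx => by
    simp only [hηdef, hψdef, hV, norm_smul, hne, Real.exp_log (norm_pos_iff.2 hx), mul_one, norm_norm]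
  have h₁ : ∀ s, HasDerivAt η (deriv η s) s := fun s =>
    (hηC.differentiable (by norm_num) s).hasDerivAt
  have h₂ : ∀ s, HasDerivAt (deriv η) (deriv (deriv η) s) s := fun s =>
    ((hηC.deriv' (n := 1) |>.differentiable (by norm_num)) s).hasDerivAt
  have hne0 : ∀ s, Real.exp s • e ≠ 0 := fun s =>
    smul_ne_zero (Real.exp_pos s).ne' (norm_ne_zero_iff.1 (by rw [hne]; exact one_ne_zero))
  have hlog : ∀ s, Real.log ‖Real.exp s • e‖ = s := fun s => by
    rw [norm_smul, hne, mul_one, Real.norm_eq_abs, abs_of_pos (Real.exp_pos s), Real.log_exp]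
  have hcurve : Tendsto (fun s => Real.exp s • e) atBot (𝓝 0) := by
    simpa using Real.tendsto_exp_atBot.smul_const e
  have hηbot : Tendsto η atBot (𝓝 (ψ 0)) := (hψ.continuous.tendsto 0).comp hcurve
  -- By the chain rule `η'` is `dψ` at `x` applied to `x` itself, for `x = exp s • e`, which tends
  -- to the origin.
  have hη₁bot : Tendsto (deriv η) atBot (𝓝 0) := by
    have hd : deriv η = fun s => fderiv ℝ ψ (Real.exp s • e) (Real.exp s • e) := funext fun s =>
      (HasFDerivAt.comp_hasDerivAt (f := fun s => Real.exp s • e) s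
        (hψ.differentiable (by norm_num) (Real.exp s • e)).hasFDerivAt
        ((Real.hasDerivAt_exp s).smul_const e)).deriv
    rw [hd]
    have hc : Continuous fun x => fderiv ℝ ψ x x :=
      (hψ.continuous_fderiv (by norm_num)).clm_apply continuous_id
    have ht := (hc.tendsto 0).comp hcurve
    rwa [map_zero] at ht
  obtain ⟨hlim₁, hlim₂, hlim⟩ := cylinder_ode_tendsto (N := n) (ρ := ρ) (β := β)
    (y := fun s => s + η s) (y₁ := fun s => 1 + deriv η s) (y₂ := deriv (deriv η))
    (by linarith) hρ (by linarith)
    (fun s => (hasDerivAt_id s).add (h₁ s)) (fun s => (h₂ s).const_add 1)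
    (fun s => hv.radial_ode hn hm hα hη h₁ h₂ (hne0 s) (hlog s))
    (tendsto_id.atBot_add hηbot) (by simpa using hη₁bot.const_add 1)
  have hη₁ : Tendsto (deriv η) atTop (𝓝 (-1)) := by
    simpa using hlim₁.const_add (-1)
  have hL : ((n : ℝ) - 1) * ((n : ℝ) - 2) / ρ ≠ 0 := by positivity
  have hscale : ∀ x : EuclideanSpace ℝ (Fin n), x ≠ 0 → ‖x‖ ^ 2 * Real.exp (2 * ψ x) =
      Real.exp (2 * (Real.log ‖x‖ + η (Real.log ‖x‖))) := fun x hx => by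
    rw [hη x hx, mul_add, Real.exp_add, exp_two_mul_log (norm_pos_iff.2 hx)]
  rw [hv.yamabe_eq_conformal]
  refine ⟨?_, ?_, ?_, ?_⟩
  · have hVr : ∀ r, 0 < r → V r = Real.exp (((n : ℝ) + 2) / 2 * η (Real.log r)) := fun r hr => by
      simp only [hηdef, hψdef, Real.exp_log hr]
      rw [← mul_assoc, div_mul_div_cancel₀ two_ne_zero, div_self hn2, one_mul,
        Real.exp_log (hv.pos _), hV, norm_smul, hne, mul_one, Real.norm_of_nonneg hr.le]
    have ht := (hη₁.comp Real.tendsto_log_atTop).const_mul (((n : ℝ) + 2) / 2)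
    rw [show -2 / (1 - m) = ((n : ℝ) + 2) / 2 * -1 by rw [h1m]; field_simp; norm_num]
    refine ht.congr' ?_
    filter_upwards [eventually_gt_atTop 0] with r hr
    have hd := (((h₁ (Real.log r)).comp r (Real.hasDerivAt_log hr.ne')).const_mul
      (((n : ℝ) + 2) / 2)).exp
    have hd' := hd.congr_of_eventuallyEq ((lt_mem_nhds hr).mono hVr)
    rw [hd'.deriv, hVr r hr]
    have := (Real.exp_pos (((n : ℝ) + 2) / 2 * η (Real.log r))).ne'
    simp only [Function.comp_apply]
    field_simp
  -- The origin needs its own value: the formula in `log r` is derived only for `x ≠ 0`, and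
  -- `Real.log 0 = 0` would make it return the value at `r = 1`.
  · refine ⟨fun r => if r = 0 then scalarCurvature (conformal ψ) 0 else
      -2 * ((n : ℝ) - 1) * (((n : ℝ) - 2) * (deriv η (Real.log r) + deriv η (Real.log r) ^ 2 / 2) +
        deriv (deriv η) (Real.log r)) / Real.exp (2 * (Real.log r + η (Real.log r))), fun x => ?_, ?_⟩
    · rcases eq_or_ne x 0 with rfl | hx
      · simp [hψdef]
      · simp only [norm_eq_zero, hx, if_false]
        rw [scalarCurvature_radial hψ hη h₁ h₂ hx, hscale x hx]
    · have ht := ((((hη₁.add ((hη₁.pow 2).div_const 2)).const_mul ((n : ℝ) - 2)).add hlim₂).const_mul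
        (-2 * ((n : ℝ) - 1))).div hlim hL
      rw [show -2 * ((n : ℝ) - 1) * (((n : ℝ) - 2) * (-1 + (-1) ^ 2 / 2) + 0) /
        (((n : ℝ) - 1) * ((n : ℝ) - 2) / ρ) = ρ by field_simp; ring] at ht
      refine (ht.comp Real.tendsto_log_atTop).congr' ?_
      filter_upwards [eventually_gt_atTop 0] with r hr
      rw [if_neg hr.ne']
      rfl
  · refine ⟨fun r => -deriv (deriv η) (Real.log r) /
      Real.exp (2 * (Real.log r + η (Real.log r))), fun x u hxu => ?_, ?_⟩
    · rw [sectionalCurvature_radial_plane hψ hη h₁ h₂ hxu, hscale x (hxu.ne_zero 0)]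
    · have ht := hlim₂.neg.div hlim hL
      rw [neg_zero, zero_div] at ht
      exact ht.comp Real.tendsto_log_atTop
  · refine ⟨fun r => -(2 * deriv η (Real.log r) + deriv η (Real.log r) ^ 2) /
      Real.exp (2 * (Real.log r + η (Real.log r))), fun x u w hx hu hw huw => ?_, ?_⟩
    · rw [sectionalCurvature_tangent_plane hψ hη h₁ h₂ hx hu hw huw, hscale x hx]
    · have ht := ((hη₁.const_mul 2).add (hη₁.pow 2)).neg.div hlim hL
      rw [show -(2 * -1 + (-1 : ℝ) ^ 2) / (((n : ℝ) - 1) * ((n : ℝ) - 2) / ρ) =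
        ρ / (((n : ℝ) - 1) * ((n : ℝ) - 2)) by field_simp; norm_num] at ht
      exact ht.comp Real.tendsto_log_atTop
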